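/- Let $DL(m)$ denote the free bounded distributive lattice on $m$ generators (terms in $\bot,\top,\vee,\wedge$ modulo the equational theory of bounded distributive lattices). Let $\Box$ be the cube category: its objects are the natural numbers, a morphism $m\to n$ is an $n$-tuple of elements of $DL(m)$, and composition is substitution (so $\Box$ is the Lawvere theory of bounded distributive lattices, i.e. the opposite of the Kleisli category of the free distributive lattice monad $DL$ on finite sets, with objects taken up to bijection). Let $\mathcal X$ be a topos (an elementary topos, for example a Grothendieck topos). A functor $F:\mathcal C\to\mathcal X$ is \emph{flat} if it is filtering, in the internal sense of $\mathcal X$: (i) the family of all maps $F(c)\to 1$, $c\in\mathcal C$, is jointly epimorphic; (ii) for all objects $c,d$ of $\mathcal C$, the family of maps $(F\alpha,F\beta):F(b)\to F(c)\times F(d)$, indexed by all $b$, $\alpha:b\to c$, $\beta:b\to d$, is jointly epimorphic; (iii) for all parallel $\alpha,\beta:c\to d$, the family of maps $F(b)\to\mathrm{Eq}(F\alpha,F\beta)$ induced by all $\gamma:b\to c$ with $\alpha\gamma=\beta\gamma$ is jointly epimorphic. For an internal bounded distributive lattice $D$ in $\mathcal X$, let $S_D:\Box\to\mathcal X$ be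 the functor with $S_D(n)=D^n$ which sends an $n$-tuple of polynomials in $DL(m)$ to the morphism $D^m\to D^n$ that it defines. The lattice $D$ is \emph{flat} if, for all morphisms $\alpha,\beta:m\to n$ of $\Box$, the family of morphisms $D^k\to\mathrm{Eq}(S_D\alpha,S_D\beta)\subseteq D^m$ induced by the $S_D\gamma$, for all $\gamma:k\to m$ in $\Box$ with $\alpha\gamma=\beta\gamma$, is jointly epimorphic; that is, internally, whenever $d\in D^m$ satisfies $\alpha d=\beta d$, there are such a $\gamma$ and a $d'\in D^k$ with $\gamma d'=d$. \textbf{Proposition.} Every flat functor $F:\Box\to\mathcal X$ is naturally isomorphic to $S_D$ for some flat distributive lattice $D$ in $\mathcal X$. -/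

import Mathlib

open CategoryTheory Limits MonoidalCategory CartesianMonoidalCategory

universe v u

/-! # Free bounded distributive lattices -/

/-- Terms in the language `⊥, ⊤, ⊔, ⊓` of (bounded) distributive lattices, with variables
in `α`. -/
inductive LatTerm (α : Type u) : Type u
  | var : α → LatTerm α
  | bot : LatTerm α
  | top : LatTerm α
  | sup : LatTerm α → LatTerm α → LatTerm α
  | inf : LatTerm α → LatTerm α → LatTerm α

/-- Provable equality of terms in the equational theory of (bounded) distributive lattices. -/
inductive LatTerm.Eqv {α : Type u} : LatTerm α → LatTerm α → Prop
  | refl (a : LatTerm α) : Eqv a a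
  | symm {a b : LatTerm α} : Eqv a b → Eqv b a
  | trans {a b c : LatTerm α} : Eqv a b → Eqv b c → Eqv a c
  | sup_congr {a a' b b' : LatTerm α} : Eqv a a' → Eqv b b' → Eqv (sup a b) (sup a' b')
  | inf_congr {a a' b b' : LatTerm α} : Eqv a a' → Eqv b b' → Eqv (inf a b) (inf a' b')
  | sup_comm (a b : LatTerm α) : Eqv (sup a b) (sup b a)
  | sup_assoc (a b c : LatTerm α) : Eqv (sup (sup a b) c) (sup a (sup b c))
  | inf_comm (a b : LatTerm α) : Eqv (inf a b) (inf b a)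
  | inf_assoc (a b c : LatTerm α) : Eqv (inf (inf a b) c) (inf a (inf b c))
  | sup_inf_self (a b : LatTerm α) : Eqv (sup a (inf a b)) a
  | inf_sup_self (a b : LatTerm α) : Eqv (inf a (sup a b)) a
  | sup_inf_left (a b c : LatTerm α) : Eqv (sup a (inf b c)) (inf (sup a b) (sup a c))
  | sup_bot (a : LatTerm α) : Eqv (sup a bot) a
  | inf_top (a : LatTerm α) : Eqv (inf a top) a

/-- The setoid of provable equality. -/
def LatTerm.setoid (α : Type u) : Setoid (LatTerm α) :=
  ⟨LatTerm.Eqv, LatTerm.Eqv.refl, LatTerm.Eqv.symm, LatTerm.Eqv.trans⟩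

/-- The free (bounded) distributive lattice `DL(α)` on `α`: terms modulo provable equality. -/
def FreeDL (α : Type u) : Type u := Quotient (LatTerm.setoid α)

namespace FreeDL

variable {α : Type u}

instance : Lattice (FreeDL α) :=
  letI : Max (FreeDL α) := ⟨Quotient.map₂ LatTerm.sup (fun _ _ h _ _ k => .sup_congr h k)⟩
  letI : Min (FreeDL α) := ⟨Quotient.map₂ LatTerm.inf (fun _ _ h _ _ k => .inf_congr h k)⟩
  Lattice.mk'
    (by rintro ⟨a⟩ ⟨b⟩; exact Quotient.sound (.sup_comm a b))
    (by rintro ⟨a⟩ ⟨b⟩ ⟨c⟩; exact Quotient.sound (.sup_assoc a b c))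
    (by rintro ⟨a⟩ ⟨b⟩; exact Quotient.sound (.inf_comm a b))
    (by rintro ⟨a⟩ ⟨b⟩ ⟨c⟩; exact Quotient.sound (.inf_assoc a b c))
    (by rintro ⟨a⟩ ⟨b⟩; exact Quotient.sound (.sup_inf_self a b))
    (by rintro ⟨a⟩ ⟨b⟩; exact Quotient.sound (.inf_sup_self a b))

instance : DistribLattice (FreeDL α) where
  le_sup_inf := by
    rintro ⟨a⟩ ⟨b⟩ ⟨c⟩
    exact le_of_eq (Quotient.sound (.symm (.sup_inf_left a b c)))

instance : BoundedOrder (FreeDL α) where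
  top := Quotient.mk _ .top
  bot := Quotient.mk _ .bot
  le_top := by rintro ⟨a⟩; exact inf_eq_left.mp (Quotient.sound (.inf_top a))
  bot_le := by rintro ⟨a⟩; exact sup_eq_left.mp (Quotient.sound (.sup_bot a))

/-- The generators of the free distributive lattice. -/
def var (a : α) : FreeDL α := Quotient.mk _ (.var a)

end FreeDL

/-- The value of a term under an assignment of its variables. -/
def LatTerm.eval {α : Type u} {L : Type v} [DistribLattice L] [BoundedOrder L] (f : α → L) :
    LatTerm α → L
  | .var a => f a
  | .bot => ⊥
  | .top => ⊤
  | .sup a b => a.eval f ⊔ b.eval f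
  | .inf a b => a.eval f ⊓ b.eval f

theorem LatTerm.Eqv.eval_eq {α : Type u} {L : Type v} [DistribLattice L] [BoundedOrder L]
    (f : α → L) {a b : LatTerm α} (h : LatTerm.Eqv a b) : a.eval f = b.eval f := by
  induction h with
  | refl => rfl
  | symm _ ih => exact ih.symm
  | trans _ _ ih ih' => exact ih.trans ih'
  | sup_congr _ _ ih ih' => simp only [LatTerm.eval, ih, ih']
  | inf_congr _ _ ih ih' => simp only [LatTerm.eval, ih, ih']
  | sup_comm a b => exact _root_.sup_comm _ _
  | sup_assoc a b c => exact _root_.sup_assoc _ _ _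
  | inf_comm a b => exact _root_.inf_comm _ _
  | inf_assoc a b c => exact _root_.inf_assoc _ _ _
  | sup_inf_self a b => exact _root_.sup_inf_self
  | inf_sup_self a b => exact _root_.inf_sup_self
  | sup_inf_left a b c => exact _root_.sup_inf_left _ _ _
  | sup_bot a => exact sup_bot_eq _
  | inf_top a => exact inf_top_eq _

namespace FreeDL

variable {α : Type u} {L : Type v} [DistribLattice L] [BoundedOrder L]

/-- The universal property of the free distributive lattice: the homomorphism extending a map on
generators. For `f : n → L` and `t : DL(n)`, `lift f t` is the value of the polynomial `t`
at `f`. -/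
def lift (f : α → L) : BoundedLatticeHom (FreeDL α) L where
  toFun := Quotient.lift (LatTerm.eval f) (fun _ _ h => LatTerm.Eqv.eval_eq f h)
  map_sup' := by rintro ⟨a⟩ ⟨b⟩; rfl
  map_inf' := by rintro ⟨a⟩ ⟨b⟩; rfl
  map_top' := rfl
  map_bot' := rfl

@[simp] theorem lift_var (f : α → L) (a : α) : lift f (var a) = f a := rfl

theorem hom_ext {g h : BoundedLatticeHom (FreeDL α) L} (e : ∀ a, g (var a) = h (var a)) :
    g = h := by
  ext t
  obtain ⟨t, rfl⟩ := Quotient.exists_rep t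
  induction t with
  | var a => exact e a
  | bot => exact (map_bot g).trans (map_bot h).symm
  | top => exact (map_top g).trans (map_top h).symm
  | sup a b ha hb =>
    let a' : FreeDL α := Quotient.mk _ a
    let b' : FreeDL α := Quotient.mk _ b
    exact (map_sup g a' b').trans ((congrArg₂ _ ha hb).trans (map_sup h a' b').symm)
  | inf a b ha hb =>
    let a' : FreeDL α := Quotient.mk _ a
    let b' : FreeDL α := Quotient.mk _ b
    exact (map_inf g a' b').trans ((congrArg₂ _ ha hb).trans (map_inf h a' b').symm)

theorem lift_var_self (t : FreeDL α) : lift var t = t :=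
  DFunLike.congr_fun (hom_ext (g := lift var) (h := BoundedLatticeHom.id _) (fun _ => rfl)) t

theorem map_lift {M : Type*} [DistribLattice M] [BoundedOrder M] (h : BoundedLatticeHom L M)
    (f : α → L) (t : FreeDL α) : h (lift f t) = lift (fun a => h (f a)) t :=
  DFunLike.congr_fun (hom_ext (g := h.comp (lift f)) (h := lift fun a => h (f a))
    (fun _ => rfl)) t

end FreeDL

/-! # The cube category -/

/-- Objects of the cube category `□`: natural numbers (the dimensions of the cubes). -/
structure Cube : Type where
  /-- The dimension of the cube. -/
  dim : ℕ

/-- The cube category: the Lawvere theory of distributive lattices, i.e. the opposite of the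
Kleisli category of the free distributive lattice monad `DL`. A morphism `m ⟶ n` is a map
`n → DL(m)`, that is, an `n`-tuple of lattice polynomials in `m` variables; composition is
substitution. -/
instance : Category.{0} Cube where
  Hom m n := Fin n.dim → FreeDL (Fin m.dim)
  id _ := FreeDL.var
  comp f g := fun i => FreeDL.lift f (g i)
  id_comp f := funext fun i => FreeDL.lift_var_self (f i)
  comp_id _ := rfl
  assoc f g h := funext fun i => (FreeDL.map_lift (FreeDL.lift f) g (h i)).symm

/-! # Flat functors -/

/-- A family of morphisms with common target is (jointly) epimorphic. -/
def JointlyEpic {X : Type u} [Category.{v} X] {ι : Type*} {A : ι → X} {B : X}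
    (p : ∀ i, A i ⟶ B) : Prop :=
  ∀ ⦃Z : X⦄ (g h : B ⟶ Z), (∀ i, p i ≫ g = p i ≫ h) → g = h

/-- A functor `F : C ⥤ X` to a topos is flat, i.e. filtering: the three conditions saying that
the category of elements of a set-valued functor is filtering, with "there exists" read in the
internal language of `X`, i.e. as a statement that a family of morphisms is epimorphic. -/
structure IsFlatFunctor {C : Type*} [Category* C] {X : Type u} [Category.{v} X]
    [CartesianMonoidalCategory X] [HasFiniteLimits X] (F : C ⥤ X) : Prop where
  inhabited : JointlyEpic (fun c : C => toUnit (F.obj c))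
  transitivity : ∀ c d : C,
    JointlyEpic (fun s : (b : C) × ((b ⟶ c) × (b ⟶ d)) =>
      lift (F.map s.2.1) (F.map s.2.2))
  freeness : ∀ ⦃c d : C⦄ (α β : c ⟶ d),
    JointlyEpic (fun s : (b : C) × {γ : b ⟶ c // γ ≫ α = γ ≫ β} =>
      equalizer.lift (f := F.map α) (g := F.map β) (F.map s.2.1)
        (by rw [← F.map_comp, ← F.map_comp, s.2.2]))

/-! # Distributive lattices in a topos -/

/-- An internal (bounded) distributive lattice in `X`. The equational axioms are expressed with
generalized elements `T ⟶ carrier`. -/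
structure InternalDistLat (X : Type u) [Category.{v} X] [CartesianMonoidalCategory X] where
  /-- The underlying object. -/
  carrier : X
  /-- The join. -/
  sup : carrier ⊗ carrier ⟶ carrier
  /-- The meet. -/
  inf : carrier ⊗ carrier ⟶ carrier
  /-- The least element. -/
  bot : 𝟙_ X ⟶ carrier
  /-- The greatest element. -/
  top : 𝟙_ X ⟶ carrier
  sup_comm : ∀ {T : X} (x y : T ⟶ carrier), lift x y ≫ sup = lift y x ≫ sup
  sup_assoc : ∀ {T : X} (x y z : T ⟶ carrier),
    lift (lift x y ≫ sup) z ≫ sup = lift x (lift y z ≫ sup) ≫ sup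
  inf_comm : ∀ {T : X} (x y : T ⟶ carrier), lift x y ≫ inf = lift y x ≫ inf
  inf_assoc : ∀ {T : X} (x y z : T ⟶ carrier),
    lift (lift x y ≫ inf) z ≫ inf = lift x (lift y z ≫ inf) ≫ inf
  sup_inf_self : ∀ {T : X} (x y : T ⟶ carrier), lift x (lift x y ≫ inf) ≫ sup = x
  inf_sup_self : ∀ {T : X} (x y : T ⟶ carrier), lift x (lift x y ≫ sup) ≫ inf = x
  sup_inf_left : ∀ {T : X} (x y z : T ⟶ carrier),
    lift x (lift y z ≫ inf) ≫ sup = lift (lift x y ≫ sup) (lift x z ≫ sup) ≫ inf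
  sup_bot : ∀ {T : X} (x : T ⟶ carrier), lift x (toUnit T ≫ bot) ≫ sup = x
  inf_top : ∀ {T : X} (x : T ⟶ carrier), lift x (toUnit T ≫ top) ≫ inf = x

namespace InternalDistLat

variable {X : Type u} [Category.{v} X] [CartesianMonoidalCategory X] (D : InternalDistLat X)

/-- Generalized elements of `D` at stage `T`. -/
def Elt (T : X) : Type v := T ⟶ D.carrier

instance (T : X) : Lattice (D.Elt T) :=
  letI : Max (D.Elt T) := ⟨fun x y => (lift x y ≫ D.sup : T ⟶ D.carrier)⟩
  letI : Min (D.Elt T) := ⟨fun x y => (lift x y ≫ D.inf : T ⟶ D.carrier)⟩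
  Lattice.mk' D.sup_comm D.sup_assoc D.inf_comm D.inf_assoc D.sup_inf_self D.inf_sup_self

/-- The generalized elements of `D` at each stage form a distributive lattice. -/
instance (T : X) : DistribLattice (D.Elt T) where
  le_sup_inf x y z := le_of_eq (D.sup_inf_left x y z).symm

instance (T : X) : BoundedOrder (D.Elt T) where
  top := (toUnit T ≫ D.top : T ⟶ D.carrier)
  bot := (toUnit T ≫ D.bot : T ⟶ D.carrier)
  le_top x := inf_eq_left.mp (D.inf_top x)
  bot_le x := sup_eq_left.mp (D.sup_bot x)

/-- Change of stage is a lattice homomorphism. -/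
def restrict {S T : X} (s : S ⟶ T) : BoundedLatticeHom (D.Elt T) (D.Elt S) where
  toFun (x : T ⟶ D.carrier) := (s ≫ x : S ⟶ D.carrier)
  map_sup' (x y : T ⟶ D.carrier) := comp_lift_assoc s x y D.sup
  map_inf' (x y : T ⟶ D.carrier) := comp_lift_assoc s x y D.inf
  map_top' := by
    change s ≫ toUnit T ≫ D.top = toUnit S ≫ D.top
    rw [comp_toUnit_assoc]
  map_bot' := by
    change s ≫ toUnit T ≫ D.bot = toUnit S ≫ D.bot
    rw [comp_toUnit_assoc]

/-- The `n`-th power `D^n`. -/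
noncomputable abbrev power (n : ℕ) : X := ∏ᶜ fun _ : Fin n => D.carrier

/-- The coordinates of the generic point of `D^n`. -/
noncomputable def coord (n : ℕ) (j : Fin n) : D.Elt (D.power n) :=
  Pi.π (fun _ : Fin n => D.carrier) j

/-- The morphism `D^m ⟶ D^n` defined by an `n`-tuple of lattice polynomials in `m` variables:
its `i`-th coordinate is the `i`-th polynomial, interpreted in `D`. -/
noncomputable def polyMap {m n : ℕ} (φ : Fin n → FreeDL (Fin m)) : D.power m ⟶ D.power n :=
  Pi.lift (fun i => (FreeDL.lift (D.coord m) (φ i) : D.Elt (D.power m)))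

theorem polyMap_π {m n : ℕ} (φ : Fin n → FreeDL (Fin m)) (i : Fin n) :
    D.polyMap φ ≫ Pi.π (fun _ : Fin n => D.carrier) i = FreeDL.lift (D.coord m) (φ i) :=
  Pi.lift_π _ _

/-- The functor `S_D : □ ⥤ X`, `n ↦ D^n`. -/
noncomputable def S : Cube ⥤ X where
  obj n := D.power n.dim
  map φ := D.polyMap φ
  map_id n := by
    refine Pi.hom_ext _ _ fun i => ?_
    rw [polyMap_π, Category.id_comp]
    rfl
  map_comp {l m n} φ ψ := by
    refine Pi.hom_ext _ _ fun i => ?_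
    rw [Category.assoc, polyMap_π, polyMap_π]
    have h := FreeDL.map_lift (D.restrict (D.polyMap φ)) (D.coord m.dim) (ψ i)
    have e : (fun a => D.restrict (D.polyMap φ) (D.coord m.dim a)) =
        fun a => FreeDL.lift (D.coord l.dim) (φ a) :=
      funext fun a => D.polyMap_π φ a
    rw [e, ← FreeDL.map_lift] at h
    exact h.symm

/-- A distributive lattice `D` in `X` is flat if, for all tuples of polynomials `α, β : n → DL(m)`
and all `d : D^m` with `α d = β d`, there exist `γ : m → DL(k)` with `αγ = βγ` and `d' : D^k`
with `γ d' = d`. The existence statement is read in the internal language of `X`: the morphisms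
`D^k ⟶ {d : D^m | α d = β d}` induced by these `γ` are jointly epimorphic. -/
def IsFlat [HasFiniteLimits X] : Prop :=
  ∀ ⦃m n : Cube⦄ (α β : m ⟶ n),
    JointlyEpic (fun s : (k : Cube) × {γ : k ⟶ m // γ ≫ α = γ ≫ β} =>
      equalizer.lift (f := D.S.map α) (g := D.S.map β) (D.S.map s.2.1)
        (by rw [← D.S.map_comp, ← D.S.map_comp, s.2.2]))

end InternalDistLat

/-! A filtering functor preserves finite limits; here only finite products are needed. `Cube` is the
Lawvere theory of distributive lattices, so a product-preserving `F` amounts to an internal lattice: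
`D = F(1)`, with operations the images of the polynomials, and `F(n) ≅ D^n` naturally. Under this
isomorphism condition (iii) for `F` becomes flatness of `D`. For products, inhabitation and
transitivity make the comparison maps epic. For binary products, freeness helps make them monic, and
a topos is balanced. The monicity argument is elementwise: "there exist" means passing to a cover.
What legitimizes this is `JointlyEpic.eq_of_pullback`, the stability of jointly epic families under
pullback, phrased without coproducts or unions so that arbitrary families are allowed in an
elementary topos. -/

/-! # Local reasoning along jointly epimorphic families -/

section Topos

variable {X : Type u} [Category.{v} X]

/-! ### Subobjects and their characteristic maps -/

section Classifier

variable [HasSubobjectClassifier X]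

open HasSubobjectClassifier

/-- A generalized element lies in a subobject iff the characteristic map sends it to `truth`. -/
theorem comp_χ_eq_truth_iff {U Y T : X} (m : U ⟶ Y) [Mono m] (y : T ⟶ Y) :
    y ≫ χ m = Subobject.Classifier.χ₀ _ T ≫ truth X ↔ ∃ k : T ⟶ U, k ≫ m = y := by
  constructor
  · intro h
    exact ⟨(isPullback_χ m).lift y _ h, (isPullback_χ m).lift_fst _ _ _⟩
  · rintro ⟨k, rfl⟩
    rw [Category.assoc, HasSubobjectClassifier.comm, ← Category.assoc]
    congr 1
    exact Subsingleton.elim _ _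

/-- Maps into the subobject classifier are determined by the generalized elements on which they
are true. -/
theorem eq_of_comp_eq_truth_iff [HasPullbacks X] {Y : X} (φ ψ : Y ⟶ Ω X)
    (h : ∀ ⦃T : X⦄ (y : T ⟶ Y), y ≫ φ = Subobject.Classifier.χ₀ _ T ≫ truth X ↔
      y ≫ ψ = Subobject.Classifier.χ₀ _ T ≫ truth X) : φ = ψ := by
  -- The subobject classified by `φ` is also classified by `ψ`, as both are true on the same
  -- elements. Taking `ψ := φ` as well, uniqueness of characteristic maps gives the result.
  have key : ∀ (φ ψ : Y ⟶ Ω X)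
      (_ : ∀ ⦃T : X⦄ (y : T ⟶ Y), y ≫ φ = Subobject.Classifier.χ₀ _ T ≫ truth X ↔
        y ≫ ψ = Subobject.Classifier.χ₀ _ T ≫ truth X),
      ψ = χ (pullback.fst φ (truth X)) := by
    intro φ ψ h
    have h₀ {T : X} (k : T ⟶ Ω₀ X) : k = Subobject.Classifier.χ₀ _ T := Subsingleton.elim _ _
    refine unique _ _ ⟨⟨(h _).1 ?_⟩, ⟨PullbackCone.IsLimit.mk _
      (fun s => pullback.lift s.fst s.snd ?_) ?_ ?_ ?_⟩⟩
    · rw [pullback.condition, h₀ (pullback.snd φ (truth X))]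
    · have := s.condition
      rw [h₀ s.snd] at this ⊢
      exact (h _).2 this
    · intro s
      exact pullback.lift_fst _ _ _
    · intro s
      exact Subsingleton.elim (α := (_ ⟶ Ω₀ X)) _ _
    · intro s l hl _
      rw [← cancel_mono (pullback.fst φ (truth X)), hl, pullback.lift_fst]
  rw [key φ φ fun _ _ => Iff.rfl, key φ ψ h]

end Classifier

variable [CartesianMonoidalCategory X] [HasFiniteLimits X] [MonoidalClosed X]
  [HasSubobjectClassifier X]

open HasSubobjectClassifier in
/-- Jointly epimorphic families in a topos are stable under pullback: to prove an equation over
`C`, given `h : C ⟶ B`, it is enough to prove it on those generalized elements of `C` whose image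
in `B` lifts to a member of a family covering `B`. -/
theorem JointlyEpic.eq_of_pullback {ι : Type*} {A : ι → X} {B C Z : X} {p : ∀ i, A i ⟶ B}
    (hp : JointlyEpic p) (h : C ⟶ B) {g₁ g₂ : C ⟶ Z}
    (H : ∀ (i : ι) ⦃T : X⦄ (t : T ⟶ A i) (c : T ⟶ C), t ≫ p i = c ≫ h → c ≫ g₁ = c ≫ g₂) :
    g₁ = g₂ := by
  let e : C ⟶ C ⊗ B := lift (𝟙 C) h
  have he : e ≫ fst C B = 𝟙 C := lift_fst _ _
  have : Mono e := mono_of_mono_fac he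
  let m := equalizer.ι g₁ g₂
  -- The graph of `h` is compared with its part over the equalizer of `g₁` and `g₂`. Currying turns
  -- their characteristic maps into maps out of `B`, which can be tested on each `A i`. There the
  -- two subobjects agree: a point of the graph over `A i` is an element to which `H` applies.
  have hφψ : χ e = χ (m ≫ e) := by
    refine MonoidalClosed.curry_injective (hp _ _ fun i => ?_)
    rw [← MonoidalClosed.curry_natural_left, ← MonoidalClosed.curry_natural_left]
    congr 1
    refine eq_of_comp_eq_truth_iff _ _ fun T y => ?_
    rw [← Category.assoc, ← Category.assoc, comp_χ_eq_truth_iff, comp_χ_eq_truth_iff]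
    constructor
    · rintro ⟨k, hk⟩
      have hf : k = y ≫ fst C (A i) := by
        simpa [e] using congrArg (· ≫ fst C B) hk
      have hs : k ≫ h = (y ≫ snd C (A i)) ≫ p i := by
        simpa [e] using congrArg (· ≫ snd C B) hk
      refine ⟨equalizer.lift k (H i (y ≫ snd C (A i)) k hs.symm), ?_⟩
      rw [equalizer.lift_ι_assoc, hk]
    · rintro ⟨k, hk⟩
      exact ⟨k ≫ m, by rw [Category.assoc, hk]⟩
  -- The whole graph thus lies over the equalizer, so `m` has a section.
  obtain ⟨k, hk⟩ := (comp_χ_eq_truth_iff (m ≫ e) e).1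
    (hφψ ▸ (comp_χ_eq_truth_iff e e).2 ⟨𝟙 C, Category.id_comp e⟩)
  have hkm : k ≫ m = 𝟙 C := by
    simpa [he] using congrArg (· ≫ fst C B) hk
  rw [← Category.id_comp g₁, ← Category.id_comp g₂, ← hkm, Category.assoc, Category.assoc,
    equalizer.condition]

/-! # Flat functors preserve finite products -/

namespace IsFlatFunctor

variable {C : Type*} [Category* C] {F : C ⥤ X}

/-- Two generalized elements are locally images of a common one. -/
theorem eq_of_transitivity (hF : IsFlatFunctor F) {c d : C} {T Z : X} (x : T ⟶ F.obj c)
    (y : T ⟶ F.obj d) {g₁ g₂ : T ⟶ Z}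
    (H : ∀ ⦃S : X⦄ (s : S ⟶ T) (b : C) (α : b ⟶ c) (β : b ⟶ d) (t : S ⟶ F.obj b),
      t ≫ F.map α = s ≫ x → t ≫ F.map β = s ≫ y → s ≫ g₁ = s ≫ g₂) : g₁ = g₂ := by
  refine (hF.transitivity c d).eq_of_pullback (lift x y) ?_
  rintro ⟨b, α, β⟩ S t s h
  refine H s b α β t ?_ ?_
  · simpa using congrArg (· ≫ fst _ _) h
  · simpa using congrArg (· ≫ snd _ _) h

/-- An element equalizing two transitions locally comes from an object equalizing them. -/
theorem eq_of_freeness (hF : IsFlatFunctor F) {c d : C} (α β : c ⟶ d) {T Z : X}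
    (x : T ⟶ F.obj c) (hx : x ≫ F.map α = x ≫ F.map β) {g₁ g₂ : T ⟶ Z}
    (H : ∀ ⦃S : X⦄ (s : S ⟶ T) (b : C) (γ : b ⟶ c) (t : S ⟶ F.obj b),
      γ ≫ α = γ ≫ β → t ≫ F.map γ = s ≫ x → s ≫ g₁ = s ≫ g₂) : g₁ = g₂ := by
  refine (hF.freeness α β).eq_of_pullback (equalizer.lift x hx) ?_
  rintro ⟨b, γ, hγ⟩ S t s h
  refine H s b γ t hγ ?_
  simpa using congrArg (· ≫ equalizer.ι _ _) h

omit [MonoidalClosed X] in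
-- Epic because every `F(b) ⟶ 1` factors through `F(c)`. Monic because the two projections of `F(c)
-- × F(c)` agree on the transitivity cover, any two maps into a terminal object being equal.
theorem isIso_toUnit (hF : IsFlatFunctor F) {c : C} (hc : IsTerminal c) :
    IsIso (toUnit (F.obj c)) := by
  have : Epi (toUnit (F.obj c)) := ⟨fun g h e => hF.inhabited g h fun b => by
    dsimp only
    rw [← comp_toUnit (F.map (hc.from b)), Category.assoc, Category.assoc, e]⟩
  have hfs : fst (F.obj c) (F.obj c) = snd (F.obj c) (F.obj c) :=
    hF.transitivity c c _ _ fun s => by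
      rw [lift_fst, lift_snd, hc.hom_ext s.2.1 s.2.2]
  have : Mono (toUnit (F.obj c)) := ⟨fun g h _ => by
    rw [← lift_fst g h, hfs, lift_snd]⟩
  exact isIso_of_mono_of_epi _

/-- Epic because each member of the transitivity cover factors through the product `e`. For
monicity, two elements with equal projections are locally images of one element under `α` and `β`;
freeness refines that element until `α` and `β` become equal. -/
theorem isIso_lift (hF : IsFlatFunctor F) {c d : C} {e : C} {p : e ⟶ c} {q : e ⟶ d}
    (hpq : IsLimit (BinaryFan.mk p q)) :
    IsIso (lift (F.map p) (F.map q)) := by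
  have : Epi (lift (F.map p) (F.map q)) := ⟨fun g h w => hF.transitivity c d g h
    fun s => by
      obtain ⟨l, h₁, h₂⟩ : ∃ l : s.1 ⟶ e, l ≫ p = s.2.1 ∧ l ≫ q = s.2.2 :=
        ⟨_, (BinaryFan.IsLimit.lift' hpq s.2.1 s.2.2).2⟩
      dsimp only
      rw [← h₁, ← h₂, F.map_comp, F.map_comp, ← comp_lift, Category.assoc, Category.assoc, w]⟩
  have : Mono (lift (F.map p) (F.map q)) := ⟨fun x y w => by
    have e₁ : x ≫ F.map p = y ≫ F.map p := by simpa using congrArg (· ≫ fst _ _) w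
    have e₂ : x ≫ F.map q = y ≫ F.map q := by simpa using congrArg (· ≫ snd _ _) w
    refine hF.eq_of_transitivity x y fun S s b α β t hα hβ => ?_
    rw [← hα, ← hβ]
    -- Freeness is used once per projection: `γ₁` equalizes the `p`-components, then `γ₂` the
    -- `q`-components.
    have ht₁ : t ≫ F.map (α ≫ p) = t ≫ F.map (β ≫ p) := by
      simp only [Functor.map_comp, reassoc_of% hα, reassoc_of% hβ, e₁]
    refine hF.eq_of_freeness _ _ t ht₁ fun S₁ s₁ b₁ γ₁ t₁ hγ₁ hs₁ => ?_
    rw [← reassoc_of% hs₁, ← reassoc_of% hs₁, ← F.map_comp, ← F.map_comp]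
    have ht₂ : t₁ ≫ F.map (γ₁ ≫ α ≫ q) = t₁ ≫ F.map (γ₁ ≫ β ≫ q) := by
      simp only [Functor.map_comp, reassoc_of% hs₁, reassoc_of% hα, reassoc_of% hβ, e₂]
    refine hF.eq_of_freeness _ _ t₁ ht₂ fun S₂ s₂ b₂ γ₂ t₂ hγ₂ hs₂ => ?_
    rw [← reassoc_of% hs₂, ← reassoc_of% hs₂, ← F.map_comp, ← F.map_comp]
    congr 2
    refine BinaryFan.IsLimit.hom_ext hpq ?_ ?_
    · change (γ₂ ≫ γ₁ ≫ α) ≫ p = (γ₂ ≫ γ₁ ≫ β) ≫ p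
      simp only [Category.assoc, hγ₁]
    · change (γ₂ ≫ γ₁ ≫ α) ≫ q = (γ₂ ≫ γ₁ ≫ β) ≫ q
      simpa only [Category.assoc] using hγ₂⟩
  exact isIso_of_mono_of_epi _

theorem preservesFiniteProducts [HasFiniteProducts C] (hF : IsFlatFunctor F) :
    PreservesFiniteProducts F := by
  have : PreservesLimitsOfShape (Discrete.{0} PEmpty) F := by
    have := hF.isIso_toUnit terminalIsTerminal
    have : PreservesLimit (Functor.empty.{0} C) F := preservesTerminal_of_iso F
      (asIso (toUnit (F.obj (⊤_ C))) ≪≫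
        isTerminalTensorUnit.uniqueUpToIso terminalIsTerminal)
    exact preservesLimitsOfShape_pempty_of_preservesTerminal F
  have : PreservesLimitsOfShape (Discrete WalkingPair) F := by
    refine ⟨fun {K} => ?_⟩
    have : PreservesLimit (pair (K.obj ⟨.left⟩) (K.obj ⟨.right⟩)) F := by
      have := hF.isIso_lift (prodIsProd (K.obj ⟨.left⟩) (K.obj ⟨.right⟩))
      refine preservesLimit_of_preserves_limit_cone (prodIsProd _ _)
        ((isLimitMapConeBinaryFanEquiv _ _ _).symm ?_)
      refine IsLimit.ofIsoLimit (tensorProductIsBinaryProduct _ _)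
        (BinaryFan.ext (asIso (lift (F.map prod.fst) (F.map prod.snd))) ?_ ?_).symm
      · exact (lift_fst _ _).symm
      · exact (lift_snd _ _).symm
    exact preservesLimit_of_iso_diagram F (diagramIsoPair K).symm
  exact .of_preserves_binary_and_terminal F

end IsFlatFunctor

end Topos

/-! # Finite products in the cube category -/

namespace Cube

/-- The morphism `m ⟶ 1` given by a single polynomial. -/
def ofPoly {m : Cube} (t : FreeDL (Fin m.dim)) : m ⟶ ⟨1⟩ := fun _ => t

theorem comp_ofPoly_var {l m : Cube} (f : l ⟶ m) (i : Fin m.dim) :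
    f ≫ ofPoly (FreeDL.var i) = ofPoly (f i) := rfl

/-- The zero-dimensional cube is terminal. -/
def isTerminalZero : IsTerminal (⟨0⟩ : Cube) :=
  IsTerminal.ofUniqueHom (fun _ i => i.elim0) fun _ _ => funext fun i => i.elim0

/-- The product of the cubes of dimensions `m` and `n` is the cube of dimension `m + n`. -/
def isLimitAdd (m n : ℕ) : IsLimit (BinaryFan.mk (P := (⟨m + n⟩ : Cube))
    (X := ⟨m⟩) (Y := ⟨n⟩) (fun i => FreeDL.var (Fin.castAdd n i))
    (fun j => FreeDL.var (Fin.natAdd m j))) :=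
  BinaryFan.isLimitMk
    (fun s => Fin.append (α := FreeDL (Fin s.pt.dim)) s.fst s.snd)
    (fun s => funext fun i =>
      Fin.append_left (s.fst : Fin m → FreeDL (Fin s.pt.dim)) (s.snd : Fin n → _) i)
    (fun s => funext fun i =>
      Fin.append_right (s.fst : Fin m → FreeDL (Fin s.pt.dim)) (s.snd : Fin n → _) i)
    (fun s l h₁ h₂ => funext fun i => by
      let f : Fin m → FreeDL (Fin s.pt.dim) := s.fst
      let g : Fin n → FreeDL (Fin s.pt.dim) := s.snd
      refine Fin.addCases (fun i => ?_) (fun i => ?_) i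
      · exact (congrFun h₁ i).trans (Fin.append_left f g i).symm
      · exact (congrFun h₂ i).trans (Fin.append_right f g i).symm)

instance : HasFiniteProducts Cube :=
  have : HasTerminal Cube := isTerminalZero.hasTerminal
  have : ∀ {m n : Cube}, HasLimit (pair m n) := fun {m n} => ⟨⟨_, isLimitAdd m.dim n.dim⟩⟩
  have : HasBinaryProducts Cube := hasBinaryProducts_of_hasLimit_pair Cube
  hasFiniteProducts_of_has_binary_and_terminal

/-- The `n`-dimensional cube is the `n`-th power of the one-dimensional one. -/
def isLimitPow (n : ℕ) : IsLimit (Fan.mk (⟨n⟩ : Cube) fun i : Fin n =>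
    (ofPoly (FreeDL.var i) : (⟨n⟩ : Cube) ⟶ ⟨1⟩)) :=
  Fan.IsLimit.mk _ (fun s i => s.proj i (0 : Fin 1))
    (fun s i => funext fun k => by
      obtain rfl : k = (0 : Fin 1) := Subsingleton.elim (α := Fin 1) _ _
      rfl)
    (fun s l h => funext fun i => congrFun (h i) (0 : Fin 1))

end Cube

/-! # The internal distributive lattice of a product-preserving functor -/

section

variable {X : Type u} [Category.{v} X] (F : Cube ⥤ X) [PreservesFiniteProducts F]

namespace Cube

/-- A functor preserving finite products sends the `n`-cube to the `n`-th power of the image of the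
interval. -/
noncomputable def isLimitMapPow (n : ℕ) : IsLimit (Fan.mk (F.obj ⟨n⟩) fun i : Fin n =>
    F.map (ofPoly (FreeDL.var i) : (⟨n⟩ : Cube) ⟶ ⟨1⟩)) :=
  isLimitFanMkObjOfIsLimit F _ _ (isLimitPow n)

theorem exists_map_var_eq {T : X} {n : ℕ} (x : Fin n → (T ⟶ F.obj ⟨1⟩)) :
    ∃ e : T ⟶ F.obj ⟨n⟩, ∀ i, e ≫ F.map (ofPoly (FreeDL.var i)) = x i :=
  ⟨Fan.IsLimit.lift (isLimitMapPow F n) x, Fan.IsLimit.fac (isLimitMapPow F n) x⟩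

theorem map_hom_ext {T : X} {n : ℕ} {e e' : T ⟶ F.obj ⟨n⟩}
    (h : ∀ i, e ≫ F.map (ofPoly (FreeDL.var i)) = e' ≫ F.map (ofPoly (FreeDL.var i))) : e = e' :=
  Fan.IsLimit.hom_ext (isLimitMapPow F n) _ _ h

variable [CartesianMonoidalCategory X]

/-- The binary operation on the image of the interval defined by a polynomial in two variables. -/
noncomputable def binOp (t : FreeDL (Fin 2)) : F.obj ⟨1⟩ ⊗ F.obj ⟨1⟩ ⟶ F.obj ⟨1⟩ :=
  (exists_map_var_eq F ![fst _ _, snd _ _]).choose ≫ F.map (ofPoly (m := ⟨2⟩) t)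

/-- Operations on elements of `F(1)` become substitution in `DL(n)`, once the elements are written
as polynomials in a common point `e` of `F(n)`. -/
theorem lift_binOp (t : FreeDL (Fin 2)) {T : X} {n : ℕ} (e : T ⟶ F.obj ⟨n⟩)
    (a b : FreeDL (Fin n)) :
    lift (e ≫ F.map (ofPoly a)) (e ≫ F.map (ofPoly b)) ≫ binOp F t =
      e ≫ F.map (ofPoly (m := ⟨n⟩) (FreeDL.lift ![a, b] t)) := by
  have h := (exists_map_var_eq F ![fst (F.obj ⟨1⟩) (F.obj ⟨1⟩), snd _ _]).choose_spec
  let f : (⟨n⟩ : Cube) ⟶ ⟨2⟩ := ![a, b]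
  have hf : ofPoly (m := ⟨n⟩) (FreeDL.lift ![a, b] t) = f ≫ ofPoly (m := ⟨2⟩) t := rfl
  rw [binOp, hf, F.map_comp, ← Category.assoc, ← Category.assoc]
  congr 1
  refine map_hom_ext F fun i => ?_
  rw [Category.assoc, h, Category.assoc, ← F.map_comp, comp_ofPoly_var]
  fin_cases i
  · exact lift_fst _ _
  · exact lift_snd _ _

/-- The constant in the image of the interval defined by a polynomial in no variables. -/
noncomputable def const (t : FreeDL (Fin 0)) : 𝟙_ X ⟶ F.obj ⟨1⟩ :=
  (exists_map_var_eq F (n := 0) fun i => i.elim0).choose ≫ F.map (ofPoly (m := ⟨0⟩) t)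

/-- Maps into `F(0)` are unique. The point `e` lets a constant be read as a polynomial in the same
variables as the other elements. -/
theorem toUnit_const (t : FreeDL (Fin 0)) {T : X} {n : ℕ} (e : T ⟶ F.obj ⟨n⟩) :
    toUnit T ≫ const F t =
      e ≫ F.map (ofPoly (m := ⟨n⟩) (FreeDL.lift (fun i => i.elim0) t)) := by
  let f : (⟨n⟩ : Cube) ⟶ ⟨0⟩ := fun i => i.elim0
  have hf : ofPoly (m := ⟨n⟩) (FreeDL.lift (fun i => i.elim0) t) = f ≫ ofPoly (m := ⟨0⟩) t := rfl
  rw [const, hf, F.map_comp, ← Category.assoc, ← Category.assoc]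
  congr 1
  exact map_hom_ext F fun i => i.elim0

theorem lift_sup {T : X} {n : ℕ} (e : T ⟶ F.obj ⟨n⟩) (a b : FreeDL (Fin n)) :
    lift (e ≫ F.map (ofPoly a)) (e ≫ F.map (ofPoly b)) ≫
      binOp F (FreeDL.var 0 ⊔ FreeDL.var 1) = e ≫ F.map (ofPoly (m := ⟨n⟩) (a ⊔ b)) :=
  lift_binOp F _ e a b

theorem lift_inf {T : X} {n : ℕ} (e : T ⟶ F.obj ⟨n⟩) (a b : FreeDL (Fin n)) :
    lift (e ≫ F.map (ofPoly a)) (e ≫ F.map (ofPoly b)) ≫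
      binOp F (FreeDL.var 0 ⊓ FreeDL.var 1) = e ≫ F.map (ofPoly (m := ⟨n⟩) (a ⊓ b)) :=
  lift_binOp F _ e a b

theorem toUnit_bot {T : X} {n : ℕ} (e : T ⟶ F.obj ⟨n⟩) :
    toUnit T ≫ const F ⊥ = e ≫ F.map (ofPoly (m := ⟨n⟩) ⊥) :=
  toUnit_const F _ e

theorem toUnit_top {T : X} {n : ℕ} (e : T ⟶ F.obj ⟨n⟩) :
    toUnit T ≫ const F ⊤ = e ≫ F.map (ofPoly (m := ⟨n⟩) ⊤) :=
  toUnit_const F _ e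

/-- The image of the interval under a functor preserving finite products is an internal
distributive lattice. -/
noncomputable def internalDistLat : InternalDistLat X where
  carrier := F.obj ⟨1⟩
  sup := binOp F (FreeDL.var 0 ⊔ FreeDL.var 1)
  inf := binOp F (FreeDL.var 0 ⊓ FreeDL.var 1)
  bot := const F ⊥
  top := const F ⊤
  sup_comm x y := by
    -- Since `F(2)` is the square of `F(1)`, `x` and `y` are the coordinates of one point `e`, and
    -- the law reduces to the same law in the free lattice. The other axioms follow in this way.
    obtain ⟨e, he⟩ := exists_map_var_eq F ![x, y]
    obtain ⟨rfl, rfl⟩ : _ ∧ _ := ⟨he 0, he 1⟩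
    rw [lift_sup, lift_sup, sup_comm]
  sup_assoc x y z := by
    obtain ⟨e, he⟩ := exists_map_var_eq F ![x, y, z]
    obtain ⟨rfl, rfl, rfl⟩ : _ ∧ _ ∧ _ := ⟨he 0, he 1, he 2⟩
    simp only [lift_sup, sup_assoc]
  inf_comm x y := by
    obtain ⟨e, he⟩ := exists_map_var_eq F ![x, y]
    obtain ⟨rfl, rfl⟩ : _ ∧ _ := ⟨he 0, he 1⟩
    rw [lift_inf, lift_inf, inf_comm]
  inf_assoc x y z := by
    obtain ⟨e, he⟩ := exists_map_var_eq F ![x, y, z]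
    obtain ⟨rfl, rfl, rfl⟩ : _ ∧ _ ∧ _ := ⟨he 0, he 1, he 2⟩
    simp only [lift_inf, inf_assoc]
  sup_inf_self x y := by
    obtain ⟨e, he⟩ := exists_map_var_eq F ![x, y]
    obtain ⟨rfl, rfl⟩ : _ ∧ _ := ⟨he 0, he 1⟩
    rw [lift_inf, lift_sup, sup_inf_self]
  inf_sup_self x y := by
    obtain ⟨e, he⟩ := exists_map_var_eq F ![x, y]
    obtain ⟨rfl, rfl⟩ : _ ∧ _ := ⟨he 0, he 1⟩
    rw [lift_sup, lift_inf, inf_sup_self]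
  sup_inf_left x y z := by
    obtain ⟨e, he⟩ := exists_map_var_eq F ![x, y, z]
    obtain ⟨rfl, rfl, rfl⟩ : _ ∧ _ ∧ _ := ⟨he 0, he 1, he 2⟩
    simp only [lift_inf, lift_sup, sup_inf_left]
  sup_bot x := by
    obtain ⟨e, he⟩ := exists_map_var_eq F ![x]
    obtain rfl : _ = x := he 0
    rw [toUnit_bot F e, lift_sup, sup_bot_eq]
  inf_top x := by
    obtain ⟨e, he⟩ := exists_map_var_eq F ![x]
    obtain rfl : _ = x := he 0
    rw [toUnit_top F e, lift_inf, inf_top_eq]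

/-- Evaluation of polynomials at the generic point of `F n`. -/
noncomputable def mapPolyHom (n : ℕ) :
    BoundedLatticeHom (FreeDL (Fin n)) ((internalDistLat F).Elt (F.obj ⟨n⟩)) where
  toFun t := F.map (ofPoly (m := ⟨n⟩) t)
  map_sup' a b := by
    have h := lift_sup F (𝟙 (F.obj ⟨n⟩)) a b
    simp only [Category.id_comp] at h
    exact h.symm
  map_inf' a b := by
    have h := lift_inf F (𝟙 (F.obj ⟨n⟩)) a b
    simp only [Category.id_comp] at h
    exact h.symm
  map_top' := by
    have h := toUnit_top F (𝟙 (F.obj ⟨n⟩))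
    simp only [Category.id_comp] at h
    exact h.symm
  map_bot' := by
    have h := toUnit_bot F (𝟙 (F.obj ⟨n⟩))
    simp only [Category.id_comp] at h
    exact h.symm

/-- `F n` is the `n`-th power of the internal lattice of `F`. -/
noncomputable def powIso [HasFiniteProducts X] (n : ℕ) :
    F.obj ⟨n⟩ ≅ (internalDistLat F).power n :=
  (isLimitMapPow F n).conePointUniqueUpToIso (productIsProduct _)

theorem powIso_hom_π [HasFiniteProducts X] (n : ℕ) (i : Fin n) :
    (powIso F n).hom ≫ Pi.π (fun _ : Fin n => (internalDistLat F).carrier) i =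
      F.map (ofPoly (FreeDL.var i)) :=
  (isLimitMapPow F n).conePointUniqueUpToIso_hom_comp (productIsProduct _) ⟨i⟩

/-- A functor on the cube category which preserves finite products is represented by its internal
lattice. -/
noncomputable def isoS [HasFiniteProducts X] : F ≅ (internalDistLat F).S :=
  NatIso.ofComponents (fun n => powIso F n.dim) fun {m n} φ => by
    refine Pi.hom_ext _ _ fun i => ?_
    have h : (internalDistLat F).restrict (powIso F m.dim).hom
        (FreeDL.lift ((internalDistLat F).coord m.dim) (φ i)) = mapPolyHom F m.dim (φ i) := by
      -- Both are lattice homomorphisms out of a free lattice, so agreement on generators suffices.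
      have e : ((internalDistLat F).restrict (powIso F m.dim).hom).comp
          (FreeDL.lift ((internalDistLat F).coord m.dim)) = mapPolyHom F m.dim :=
        FreeDL.hom_ext fun j => powIso_hom_π F m.dim j
      exact DFunLike.congr_fun e (φ i)
    have h₁ : (F.map φ ≫ (powIso F n.dim).hom) ≫ Pi.π (fun _ => (internalDistLat F).carrier) i =
        F.map (ofPoly (φ i)) :=
      (Category.assoc _ _ _).trans
        ((congrArg (F.map φ ≫ ·) (powIso_hom_π F n.dim i)).trans (F.map_comp _ _).symm)
    have h₂ : ((powIso F m.dim).hom ≫ (internalDistLat F).polyMap φ) ≫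
        Pi.π (fun _ => (internalDistLat F).carrier) i = F.map (ofPoly (φ i)) :=
      (Category.assoc _ _ _).trans
        ((congrArg ((powIso F m.dim).hom ≫ ·) ((internalDistLat F).polyMap_π φ i)).trans h)
    exact h₁.trans h₂.symm

end Cube

end

/-! ### Transport of flatness and the main theorem -/

/-- Condition (iii) of flatness is invariant under natural isomorphism. -/
theorem IsFlatFunctor.isFlat_of_iso {X : Type u} [Category.{v} X] [CartesianMonoidalCategory X]
    [HasFiniteLimits X] {F : Cube ⥤ X} (hF : IsFlatFunctor F) {D : InternalDistLat X}
    (e : F ≅ D.S) : D.IsFlat := by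
  intro m n α β Z g h w
  let E : equalizer (F.map α) (F.map β) ⟶ equalizer (D.S.map α) (D.S.map β) :=
    equalizer.lift (equalizer.ι _ _ ≫ e.hom.app m) (by
      rw [Category.assoc, Category.assoc, ← e.hom.naturality, ← e.hom.naturality,
        equalizer.condition_assoc])
  let E' : equalizer (D.S.map α) (D.S.map β) ⟶ equalizer (F.map α) (F.map β) :=
    equalizer.lift (equalizer.ι _ _ ≫ e.inv.app m) (by
      rw [Category.assoc, Category.assoc, ← e.inv.naturality, ← e.inv.naturality,
        equalizer.condition_assoc])
  -- A section of `E` is enough: it allows `E` to be cancelled on the left.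
  have hE : E' ≫ E = 𝟙 _ := equalizer.hom_ext (by simp [E, E'])
  have key : E ≫ g = E ≫ h := hF.freeness α β _ _ fun s => by
    have hs : equalizer.lift (f := F.map α) (g := F.map β) (F.map s.2.1)
          (by rw [← F.map_comp, ← F.map_comp, s.2.2]) ≫ E =
        e.hom.app s.1 ≫ equalizer.lift (f := D.S.map α) (g := D.S.map β) (D.S.map s.2.1)
          (by rw [← D.S.map_comp, ← D.S.map_comp, s.2.2]) :=
      equalizer.hom_ext (by simp [E])
    have := congrArg (fun k => e.hom.app s.1 ≫ k) (w s)
    dsimp only at this ⊢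
    rw [reassoc_of% hs, reassoc_of% hs, this]
  rw [← Category.id_comp g, ← Category.id_comp h, ← hE, Category.assoc, Category.assoc, key]

/-- Every flat functor from the cube category to a topos `X` is, up to natural isomorphism, of
the form `S_D` for a flat distributive lattice `D` in `X`. A topos is a cartesian closed category
with finite limits and a subobject classifier. -/
theorem mainTheorem6 {X : Type u} [Category.{v} X] [CartesianMonoidalCategory X]
    [HasFiniteLimits X] [MonoidalClosed X] [HasSubobjectClassifier X]
    (F : Cube ⥤ X) (hF : IsFlatFunctor F) :
    ∃ D : InternalDistLat X, D.IsFlat ∧ Nonempty (F ≅ D.S) := by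
  have := hF.preservesFiniteProducts
  exact ⟨Cube.internalDistLat F, hF.isFlat_of_iso (Cube.isoS F), ⟨Cube.isoS F⟩⟩
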